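/- Let $K$ be a field of characteristic $0$ and $n \ge 0$ an integer. Let $\sigma$ be a polynomial automorphism of $\mathbb{A}^n_K = K^n$, i.e. a bijection $\sigma : K^n \to K^n$ such that both $\sigma$ and $\sigma^{-1}$ are given by $n$-tuples of polynomials in $K[x_1,\dots,x_n]$. Let $\mathbf{q} \in K^n$ be a point, and let $X \subseteq K^n$ be a subvariety, i.e. the set of common zeros in $K^n$ of some family of polynomials in $K[x_1,\dots,x_n]$ (not necessarily irreducible). Then the set $$\{\, m \in \mathbb{Z} : \sigma^m(\mathbf{q}) \in X \,\}$$ is the union of a finite set and finitely many complete doubly-infinite arithmetic progressions, i.e. sets of the form $\{a + bk : k \in \mathbb{Z}\}$ with $a, b \in \mathbb{Z}$, $b \neq 0$ (either part of the union may be empty). -/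

import Mathlib

/-- A map `R^n → R^n` is polynomial if its coordinates are given by polynomials
`H_1, …, H_n ∈ R[x_1, …, x_n]`. -/
def IsPolynomialMap {R : Type*} [CommRing R] {n : ℕ} (f : (Fin n → R) → (Fin n → R)) : Prop :=
  ∃ H : Fin n → MvPolynomial (Fin n) R, ∀ x i, f x i = MvPolynomial.eval x (H i)

theorem IsPolynomialMap.id {R : Type*} [CommRing R] {n : ℕ} :
    IsPolynomialMap (fun x : Fin n → R => x) :=
  ⟨fun i => MvPolynomial.X i, fun x i => by simp⟩

theorem IsPolynomialMap.comp {R : Type*} [CommRing R] {n : ℕ}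
    {f g : (Fin n → R) → (Fin n → R)} (hf : IsPolynomialMap f) (hg : IsPolynomialMap g) :
    IsPolynomialMap (fun x => f (g x)) := by
  obtain ⟨H, hH⟩ := hf
  obtain ⟨G, hG⟩ := hg
  refine ⟨fun i => MvPolynomial.bind₁ G (H i), fun x i => ?_⟩
  have h : g x = fun j => MvPolynomial.eval x (G j) := funext (hG x)
  show f (g x) i = MvPolynomial.eval x (MvPolynomial.bind₁ G (H i))
  rw [hH, h]
  simp only [← MvPolynomial.coe_aeval_eq_eval, RingHom.coe_coe, MvPolynomial.aeval_bind₁]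

/-- The group of polynomial automorphisms of affine `n`-space `R^n`: the bijections
`σ : R^n → R^n` such that both `σ` and `σ⁻¹` are polynomial maps. -/
def affineAut (R : Type*) [CommRing R] (n : ℕ) : Subgroup (Equiv.Perm (Fin n → R)) where
  carrier := {σ | IsPolynomialMap (fun x => σ x) ∧ IsPolynomialMap (fun x => σ⁻¹ x)}
  one_mem' := by
    refine ⟨?_, ?_⟩
    · simpa using IsPolynomialMap.id
    · simpa using IsPolynomialMap.id
  mul_mem' := by
    rintro σ τ ⟨h1, h2⟩ ⟨h3, h4⟩
    refine ⟨?_, ?_⟩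
    · simpa only [Equiv.Perm.mul_apply] using h1.comp h3
    · simpa only [mul_inv_rev, Equiv.Perm.mul_apply] using h4.comp h2
  inv_mem' := by
    rintro σ ⟨h1, h2⟩
    exact ⟨h2, by simpa only [inv_inv] using h1⟩

/-- A (Zariski closed, possibly reducible) subvariety of affine `n`-space `K^n`: the set of common
zeros of the polynomials in an ideal of `K[x_1, …, x_n]`. -/
def IsAffineSubvariety {K : Type*} [Field K] {n : ℕ} (X : Set (Fin n → K)) : Prop :=
  ∃ I : Ideal (MvPolynomial (Fin n) K), X = MvPolynomial.zeroLocus K I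

/-- A complete doubly-infinite arithmetic progression `{a + b k : k ∈ ℤ}` with `b ≠ 0`. -/
def IsDoublyInfiniteAP (A : Set ℤ) : Prop :=
  ∃ a b : ℤ, b ≠ 0 ∧ A = {m : ℤ | ∃ k : ℤ, m = a + b * k}

/-!
The theorem is Bell's generalisation of the Skolem-Mahler-Lech theorem, proved by `p`-adic
interpolation of the orbit.

The automorphism, the point and finitely many equations of the subvariety involve finitely many
elements of `K`. The ring they generate embeds into a ring `B` that is finite and free over `ℤ_[p]`
for a suitable prime `p` (`exists_injective_hom_finite_padicInt_algebra`), so the question may be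
studied over `B`. There the `p`-adic analysis only needs the coordinates of elements of `B` with
respect to a `ℤ_[p]`-basis, and no valuation on `B` itself.

Put `P = p ^ 2`. As `B / P ^ 2` is finite, some power `T` of the automorphism is the identity modulo
`P ^ 2` as a function on `B ^ n` (`exists_pow_dvd_sub`). Looking at the Taylor expansion of
`T (q + P z)` one finds `T (q + P z) = q + P (z + P g z)` with `g` polynomial
(`exists_eq_add_mul_of_dvd_sub`). Hence for the sequence `u` of values of a polynomial along an
orbit of `T`, the `m`-th iterated difference is divisible by `P ^ m = p ^ (2m)`
(`pow_dvd_fwdDiff_iter`). Since `p ^ (2m) / m!` tends to zero, `u` is given by a Newton series whose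
coefficients relative to the products `x (x - 1) ⋯ (x - m + 1)` tend to zero. Strassmann's theorem
holds for such series, with the proof by division by `x - z` known from power series
(`finite_zeros_newtonSeries_of_lt`), so `u` has finitely many zeros or vanishes identically
(`eq_zero_of_infinite_zeros`). If `T` is the `j`-th power of the automorphism, the return set is
therefore finite or everything on each residue class modulo `j`.
-/

/-! ### Zeros of Newton series over an ultrametric field -/

section NewtonSeries

open Filter Topology Finset

variable {k : Type*} [NormedField k]

/-- The Newton interpolation series `∑ m, e m * ∏ i < m, (x - t i)` with coefficients `e` and
nodes `t`. -/
noncomputable def newtonSeries (t e : ℕ → k) (x : k) : k :=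
  ∑' m, e m * ∏ i ∈ range m, (x - t i)

variable [IsUltrametricDist k]

theorem norm_sub_le_max_of_ultrametric (x y : k) : ‖x - y‖ ≤ max ‖x‖ ‖y‖ := by
  simpa [sub_eq_add_neg] using IsUltrametricDist.norm_add_le_max x (-y)

theorem norm_prod_sub_le_one {t : ℕ → k} (ht : ∀ i, ‖t i‖ ≤ 1) {x : k} (hx : ‖x‖ ≤ 1)
    (s : Finset ℕ) : ‖∏ i ∈ s, (x - t i)‖ ≤ 1 := by
  rw [norm_prod]
  refine prod_le_one (fun _ _ => norm_nonneg _) fun i _ => ?_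
  exact (norm_sub_le_max_of_ultrametric _ _).trans (max_le hx (ht i))

theorem norm_newtonSeries_le {t e : ℕ → k} (ht : ∀ i, ‖t i‖ ≤ 1) {x : k} (hx : ‖x‖ ≤ 1)
    {C : ℝ} (hC : ∀ m, ‖e m‖ ≤ C) : ‖newtonSeries t e x‖ ≤ C := by
  refine IsUltrametricDist.norm_tsum_le_of_forall_le_of_nonneg
    ((norm_nonneg _).trans (hC 0)) fun m => ?_
  rw [norm_mul]
  exact (mul_le_of_le_one_right (norm_nonneg _) (norm_prod_sub_le_one ht hx _)).trans (hC m)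

/-- The value at `z` of the `m`-th tail of a Newton series. These values, shifted by one, are the
coefficients of the quotient of the series by `x - z`. -/
noncomputable def newtonTail (t e : ℕ → k) (z : k) (m : ℕ) : k :=
  newtonSeries (fun i => t (m + i)) (fun i => e (m + i)) z

theorem norm_newtonTail_le {t e : ℕ → k} (ht : ∀ i, ‖t i‖ ≤ 1) {z : k} (hz : ‖z‖ ≤ 1)
    {C : ℝ} {m : ℕ} (hC : ∀ i, m ≤ i → ‖e i‖ ≤ C) : ‖newtonTail t e z m‖ ≤ C :=
  norm_newtonSeries_le (fun _ => ht _) hz fun _ => hC _ (Nat.le_add_right _ _)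

theorem tendsto_newtonTail {t e : ℕ → k} (ht : ∀ i, ‖t i‖ ≤ 1)
    (he : Tendsto e atTop (𝓝 0)) {z : k} (hz : ‖z‖ ≤ 1) :
    Tendsto (newtonTail t e z) atTop (𝓝 0) := by
  rw [NormedAddGroup.tendsto_nhds_zero] at he ⊢
  intro ε hε
  obtain ⟨N, hN⟩ := eventually_atTop.1 (he (ε / 2) (half_pos hε))
  refine eventually_atTop.2 ⟨N, fun m hm => ?_⟩
  exact (norm_newtonTail_le ht hz fun i hi => (hN i (hm.trans hi)).le).trans_lt (half_lt_self hε)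

variable [CompleteSpace k]

theorem summable_newtonSeries {t e : ℕ → k} (ht : ∀ i, ‖t i‖ ≤ 1)
    (he : Tendsto e atTop (𝓝 0)) {x : k} (hx : ‖x‖ ≤ 1) :
    Summable fun m => e m * ∏ i ∈ range m, (x - t i) := by
  refine NonarchimedeanAddGroup.summable_of_tendsto_cofinite_zero ?_
  rw [Nat.cofinite_eq_atTop]
  refine squeeze_zero_norm (fun m => ?_) (tendsto_zero_iff_norm_tendsto_zero.1 he)
  rw [norm_mul]
  exact mul_le_of_le_one_right (norm_nonneg _) (norm_prod_sub_le_one ht hx _)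

theorem newtonSeries_eq_head_add {t e : ℕ → k} (ht : ∀ i, ‖t i‖ ≤ 1)
    (he : Tendsto e atTop (𝓝 0)) {x : k} (hx : ‖x‖ ≤ 1) :
    newtonSeries t e x =
      e 0 + (x - t 0) * newtonSeries (fun i => t (i + 1)) (fun i => e (i + 1)) x := by
  rw [newtonSeries, (summable_newtonSeries ht he hx).tsum_eq_zero_add, newtonSeries,
    ← tsum_mul_left]
  simp only [range_zero, prod_empty, mul_one, prod_range_succ']
  congr 1
  exact tsum_congr fun m => by ring

theorem newtonTail_eq {t e : ℕ → k} (ht : ∀ i, ‖t i‖ ≤ 1)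
    (he : Tendsto e atTop (𝓝 0)) {z : k} (hz : ‖z‖ ≤ 1) (m : ℕ) :
    newtonTail t e z m = e m + (z - t m) * newtonTail t e z (m + 1) := by
  have := newtonSeries_eq_head_add (t := fun i => t (m + i)) (e := fun i => e (m + i))
    (fun i => ht _) ((tendsto_add_atTop_iff_nat m).2 he |>.congr fun i => by rw [add_comm]) hz
  simp only [newtonTail]
  rw [this]
  simp only [add_zero, add_assoc, add_comm 1]

theorem newtonSeries_eq_add_mul {t e : ℕ → k} (ht : ∀ i, ‖t i‖ ≤ 1)
    (he : Tendsto e atTop (𝓝 0)) {x z : k} (hx : ‖x‖ ≤ 1) (hz : ‖z‖ ≤ 1) :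
    newtonSeries t e x = newtonSeries t e z +
      (x - z) * newtonSeries t (fun m => newtonTail t e z (m + 1)) x := by
  have hb := tendsto_newtonTail ht he hz
  have hb1 := (tendsto_add_atTop_iff_nat 1).2 hb
  have h0 : newtonTail t e z 0 = newtonSeries t e z := by simp [newtonTail]
  have hs := summable_newtonSeries ht hb hx
  have hs1 := summable_newtonSeries ht hb1 hx
  have hsum := hs.tsum_eq_zero_add
  have h2 := (summable_nat_add_iff 1).2 hs
  have h3 := summable_newtonSeries ht he hx
  simp only [range_zero, prod_empty, mul_one] at hsum
  rw [← h0]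
  have key : ∀ m, e m * ∏ i ∈ range m, (x - t i) =
      newtonTail t e z m * ∏ i ∈ range m, (x - t i) -
      (newtonTail t e z (m + 1) * ∏ i ∈ range (m + 1), (x - t i) -
      (x - z) * (newtonTail t e z (m + 1) * ∏ i ∈ range m, (x - t i))) := fun m => by
    rw [prod_range_succ, newtonTail_eq ht he hz m]
    ring
  rw [newtonSeries, tsum_congr key, Summable.tsum_sub hs (h2.sub (hs1.mul_left _)),
    Summable.tsum_sub h2 (hs1.mul_left _), hsum, tsum_mul_left, newtonSeries]
  ring

/-- **Strassmann's theorem** for Newton series: if from some index on all coefficients are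
uniformly smaller than the one at `N`, the series has finitely many zeros (in fact at most `N`) in
the closed unit ball. Dividing by `x - z` for a zero `z` lowers `N` by one. -/
theorem finite_zeros_newtonSeries_of_lt {t : ℕ → k} (ht : ∀ i, ‖t i‖ ≤ 1) (N : ℕ) :
    ∀ {e : ℕ → k}, Tendsto e atTop (𝓝 0) → (∃ ε < ‖e N‖, ∀ i > N, ‖e i‖ ≤ ε) →
      {x : k | ‖x‖ ≤ 1 ∧ newtonSeries t e x = 0}.Finite := by
  induction N with
  | zero =>
    rintro e he ⟨ε, hε, hle⟩
    convert Set.finite_empty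
    refine Set.eq_empty_iff_forall_notMem.2 ?_
    rintro x ⟨hx, h0⟩
    have h1 := newtonTail_eq ht he hx 0
    have h2 : newtonTail t e x 0 = newtonSeries t e x := by simp [newtonTail]
    rw [h2, h0] at h1
    have h3 : ‖newtonTail t e x (0 + 1)‖ ≤ ε := norm_newtonTail_le ht hx fun i hi => hle i hi
    have h4 : ‖e 0‖ = ‖(x - t 0) * newtonTail t e x (0 + 1)‖ := by
      rw [eq_neg_of_add_eq_zero_left h1.symm, norm_neg]
    have h5 : ‖x - t 0‖ ≤ 1 := (norm_sub_le_max_of_ultrametric _ _).trans (max_le hx (ht 0))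
    rw [norm_mul] at h4
    have := mul_le_of_le_one_left (norm_nonneg (newtonTail t e x (0 + 1))) h5
    linarith
  | succ N ih =>
    rintro e he ⟨ε, hε, hle⟩
    by_cases hz : ∃ z : k, ‖z‖ ≤ 1 ∧ newtonSeries t e z = 0
    · obtain ⟨z, hz, hz0⟩ := hz
      have hb1 := (tendsto_add_atTop_iff_nat 1).2 (tendsto_newtonTail ht he hz)
      have h3 : ∀ i > N, ‖newtonTail t e z (i + 1)‖ ≤ ε := fun i hi =>
        norm_newtonTail_le ht hz fun l hl => hle l (by omega)
      have h4 : ‖e (N + 1)‖ ≤ ‖newtonTail t e z (N + 1)‖ := by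
        have h1 := newtonTail_eq ht he hz (N + 1)
        have h5 : ‖z - t (N + 1)‖ ≤ 1 :=
          (norm_sub_le_max_of_ultrametric _ _).trans (max_le hz (ht _))
        have h6 := mul_le_of_le_one_left (norm_nonneg (newtonTail t e z (N + 1 + 1))) h5
        rw [← norm_mul] at h6
        have h7 : ‖e (N + 1)‖ ≤ max ‖newtonTail t e z (N + 1)‖
            ‖(z - t (N + 1)) * newtonTail t e z (N + 1 + 1)‖ := by
          rw [eq_sub_of_add_eq h1.symm]
          exact norm_sub_le_max_of_ultrametric _ _
        rcases le_max_iff.1 h7 with h | h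
        · exact h
        · exact absurd (h.trans (h6.trans (h3 _ (Nat.lt_succ_self N)))) (not_le.2 hε)
      refine ((ih hb1 ⟨ε, hε.trans_le h4, h3⟩).insert z).subset ?_
      rintro x ⟨hx, hx0⟩
      rw [newtonSeries_eq_add_mul ht he hx hz, hz0, zero_add, mul_eq_zero] at hx0
      rcases hx0 with h | h
      · exact Or.inl (sub_eq_zero.1 h)
      · exact Or.inr ⟨hx, h⟩
    · convert Set.finite_empty
      exact Set.eq_empty_iff_forall_notMem.2 fun x hx => hz ⟨x, hx⟩

/-- A Newton series with coefficients tending to zero and infinitely many zeros in the closed unit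
ball vanishes coefficientwise. -/
theorem coeff_eq_zero_of_infinite_zeros_newtonSeries {t e : ℕ → k} (ht : ∀ i, ‖t i‖ ≤ 1)
    (he : Tendsto e atTop (𝓝 0)) (h : {x : k | ‖x‖ ≤ 1 ∧ newtonSeries t e x = 0}.Infinite)
    (m : ℕ) : e m = 0 := by
  by_contra hm
  -- the last index at which the coefficient is at least as large as `e m`
  have hpos : 0 < ‖e m‖ := norm_pos_iff.2 hm
  have hlarge : ∀ δ > 0, {i | δ ≤ ‖e i‖}.Finite := fun δ hδ => by
    have := NormedAddGroup.tendsto_nhds_zero.1 he δ hδ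
    rw [← Nat.cofinite_eq_atTop, eventually_cofinite] at this
    simpa using this
  obtain ⟨N, hN, hmax⟩ := (hlarge _ hpos).exists_maximal ⟨m, le_refl ‖e m‖⟩
  have hlt : ∀ i > N, ‖e i‖ < ‖e N‖ := fun i hi => by
    by_contra hcon
    exact absurd (hmax (le_trans hN (not_lt.1 hcon)) hi.le) (not_le.2 hi)
  refine h (finite_zeros_newtonSeries_of_lt ht N he ?_)
  -- only finitely many later coefficients exceed half of `‖e N‖`, so the bound is uniform
  have hNpos : 0 < ‖e N‖ := hpos.trans_le hN
  have hfin : {i | N < i ∧ ‖e N‖ / 2 ≤ ‖e i‖}.Finite :=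
    (hlarge _ (half_pos hNpos)).subset fun i hi => hi.2
  rcases Set.eq_empty_or_nonempty {i | N < i ∧ ‖e N‖ / 2 ≤ ‖e i‖} with hemp | hne
  · refine ⟨‖e N‖ / 2, half_lt_self hNpos, fun i hi => le_of_not_ge fun hge => ?_⟩
    exact (Set.eq_empty_iff_forall_notMem.1 hemp i) ⟨hi, hge⟩
  · obtain ⟨M, hM, hMmax⟩ := Set.exists_max_image _ (fun i => ‖e i‖) hfin hne
    refine ⟨‖e M‖, hlt M hM.1, fun i hi => ?_⟩
    by_cases hge : ‖e N‖ / 2 ≤ ‖e i‖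
    · exact hMmax i ⟨hi, hge⟩
    · exact (not_le.1 hge).le.trans hM.2

end NewtonSeries

/-! ### Sequences with highly divisible iterated differences -/

section Interpolation

open Filter Topology Finset

theorem fwdDiff_iter_comp_neg {G : Type*} [AddCommGroup G] (u : ℤ → G) (m : ℕ) (l : ℤ) :
    ((fwdDiff 1)^[m] fun l => u (-l)) l = (-1 : ℤ) ^ m • ((fwdDiff 1)^[m] u) (-l - m) := by
  induction m generalizing l with
  | zero => simp
  | succ m ih =>
    rw [Function.iterate_succ_apply', Function.iterate_succ_apply', fwdDiff, fwdDiff, ih, ih,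
      pow_succ, mul_neg_one, neg_smul, ← smul_neg, neg_sub, ← smul_sub]
    push_cast
    congr 3 <;> ring_nf

/-- Since `m!` has `p`-adic valuation at most `m`, the factor `p ^ (2m)` more than compensates the
denominator `m!`, for every prime `p` including `2`. -/
theorem Padic.norm_pow_two_mul_div_factorial_le {p : ℕ} [Fact p.Prime] (m : ℕ) :
    ‖(p : ℚ_[p]) ^ (2 * m) / (m.factorial : ℚ_[p])‖ ≤ (p : ℝ)⁻¹ ^ m := by
  have hp : (1 : ℝ) < p := by exact_mod_cast (Fact.out : p.Prime).one_lt
  have h1 : padicValNat p m.factorial ≤ m := by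
    have h := sub_one_mul_padicValNat_factorial (p := p) m
    have h2 : 1 ≤ p - 1 := Nat.le_sub_one_of_lt (Fact.out : p.Prime).one_lt
    calc padicValNat p m.factorial ≤ (p - 1) * padicValNat p m.factorial :=
          Nat.le_mul_of_pos_left _ h2
      _ ≤ m := h ▸ Nat.sub_le _ _
  rw [norm_div, norm_pow, Padic.norm_p, Padic.norm_eq_zpow_neg_valuation
    (by exact_mod_cast m.factorial_ne_zero), Padic.valuation_natCast, div_eq_mul_inv,
    zpow_neg, inv_inv, zpow_natCast]
  calc ((p : ℝ)⁻¹) ^ (2 * m) * (p : ℝ) ^ padicValNat p m.factorial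
      ≤ ((p : ℝ)⁻¹) ^ (2 * m) * (p : ℝ) ^ m := by gcongr; exact hp.le
    _ = (p : ℝ)⁻¹ ^ m := by
      rw [two_mul, pow_add, mul_assoc, ← mul_pow, inv_mul_cancel₀ (by positivity), one_pow, mul_one]

/-- At a natural number, the Newton series with nodes `0, 1, 2, …` and coefficients `c m / m!` is
the finite sum of the Gregory-Newton formula. -/
theorem newtonSeries_natCast {k : Type*} [NormedField k] [CharZero k] (c : ℕ → k) (l : ℕ) :
    newtonSeries (fun i => (i : k)) (fun m => c m / m.factorial) l =
      ∑ m ∈ range (l + 1), (l.choose m : k) * c m := by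
  have hprod : ∀ m, ∏ i ∈ range m, ((l : k) - i) = (l.descFactorial m : k) := fun m => by
    rw [Nat.descFactorial_eq_prod_range, Nat.cast_prod]
    by_cases hm : m ≤ l
    · refine prod_congr rfl fun i hi => ?_
      rw [Nat.cast_sub ((mem_range.1 hi).le.trans hm)]
    · rw [prod_eq_zero (mem_range.2 (not_le.1 hm)) (sub_self _),
        prod_eq_zero (mem_range.2 (not_le.1 hm)) (by simp)]
  rw [newtonSeries, tsum_eq_sum (s := range (l + 1))]
  · refine sum_congr rfl fun m _ => ?_
    have : (m.factorial : k) ≠ 0 := by exact_mod_cast m.factorial_ne_zero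
    rw [hprod, Nat.descFactorial_eq_factorial_mul_choose]
    push_cast
    field_simp
  · intro m hm
    rw [hprod, Nat.descFactorial_of_lt (not_le.1 fun h => hm (mem_range.2 (Nat.lt_succ_of_le h)))]
    simp

variable {p : ℕ} [Fact p.Prime] {u : ℤ → ℤ_[p]}

/-- To the right of `l₀` the sequence is a Newton series with coefficients
`Δ ^ m u l₀ / m!`, which tend to zero; Strassmann's theorem then applies. -/
theorem eq_zero_of_infinite_natural_zeros
    (hu : ∀ (m : ℕ) (l : ℤ), (p : ℤ_[p]) ^ (2 * m) ∣ ((fwdDiff 1)^[m] u) l) (l₀ : ℤ)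
    (h : {l : ℕ | u (l₀ + l) = 0}.Infinite) (l : ℕ) : u (l₀ + l) = 0 := by
  set c : ℕ → ℚ_[p] := fun m => (((fwdDiff 1)^[m] u) l₀ : ℤ_[p]) with hc
  have hval : ∀ l : ℕ, newtonSeries (fun i => (i : ℚ_[p])) (fun m => c m / m.factorial) l =
      (u (l₀ + l) : ℤ_[p]) := fun l => by
    have h1 := shift_eq_sum_fwdDiff_iter (1 : ℤ) u l l₀
    rw [newtonSeries_natCast]
    simp only [nsmul_eq_mul, mul_one] at h1
    rw [h1, PadicInt.coe_sum]
    simp [hc]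
  have he : Tendsto (fun m => c m / (m.factorial : ℚ_[p])) atTop (𝓝 0) := by
    have hp : (p : ℝ)⁻¹ < 1 :=
      inv_lt_one_of_one_lt₀ (by exact_mod_cast (Fact.out : p.Prime).one_lt)
    refine squeeze_zero_norm (fun m => ?_)
      (tendsto_pow_atTop_nhds_zero_of_lt_one (by positivity) hp)
    obtain ⟨d, hd⟩ := hu m l₀
    refine le_trans ?_ (Padic.norm_pow_two_mul_div_factorial_le m)
    have : c m = (p : ℚ_[p]) ^ (2 * m) * (d : ℚ_[p]) := by simp [hc, hd]
    rw [this, mul_div_right_comm, norm_mul]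
    exact mul_le_of_le_one_right (norm_nonneg _) d.norm_le_one
  have hnode : ∀ i : ℕ, ‖(i : ℚ_[p])‖ ≤ 1 := fun i => by
    simpa only [PadicInt.norm_def, PadicInt.coe_natCast] using PadicInt.norm_le_one (i : ℤ_[p])
  have hinf : {x : ℚ_[p] | ‖x‖ ≤ 1 ∧
      newtonSeries (fun i => (i : ℚ_[p])) (fun m => c m / m.factorial) x = 0}.Infinite := by
    refine (h.image (f := fun l : ℕ => (l : ℚ_[p])) Nat.cast_injective.injOn).mono ?_
    rintro _ ⟨l, hl, rfl⟩
    exact ⟨hnode l, by rw [hval, hl.out]; rfl⟩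
  have hzero := coeff_eq_zero_of_infinite_zeros_newtonSeries hnode he hinf
  have := hval l
  simp only [hzero, newtonSeries, zero_mul, tsum_zero] at this
  exact Subtype.ext this.symm

/-- A two-sided sequence of `p`-adic integers whose `m`-th differences are divisible by `p ^ (2m)`
is given by a Newton series in every direction, so infinitely many zeros force it to vanish. -/
theorem eq_zero_of_infinite_zeros
    (hu : ∀ (m : ℕ) (l : ℤ), (p : ℤ_[p]) ^ (2 * m) ∣ ((fwdDiff 1)^[m] u) l)
    (h : {l : ℤ | u l = 0}.Infinite) (l : ℤ) : u l = 0 := by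
  -- infinitely many zeros on the right suffice: restart the Newton series further to the left
  have right : ∀ v : ℤ → ℤ_[p],
      (∀ (m : ℕ) (l : ℤ), (p : ℤ_[p]) ^ (2 * m) ∣ ((fwdDiff 1)^[m] v) l) →
      {l : ℤ | 0 ≤ l ∧ v l = 0}.Infinite → ∀ l, v l = 0 := by
    intro v hv hinf l
    have hN : {i : ℕ | v (-|l| + i) = 0}.Infinite := by
      refine Set.Infinite.mono ?_ (hinf.image (f := fun i : ℤ => (i + |l|).toNat) ?_)
      · rintro _ ⟨i, ⟨hi, hv0⟩, rfl⟩
        have : 0 ≤ i + |l| := add_nonneg hi (abs_nonneg l)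
        simp only [Set.mem_ofPred_eq, Int.toNat_of_nonneg this]
        rw [← hv0]
        congr 1
        ring
      · rintro i ⟨hi, -⟩ j ⟨hj, -⟩ hij
        have := abs_nonneg l
        simp only at hij
        omega
    have := eq_zero_of_infinite_natural_zeros hv (-|l|) hN (l + |l|).toNat
    rw [Int.toNat_of_nonneg (by linarith [neg_abs_le l])] at this
    simpa using this
  have hsplit : {l : ℤ | u l = 0} =
      {l | 0 ≤ l ∧ u l = 0} ∪ {l | l ≤ 0 ∧ u l = 0} := by
    ext l
    have := le_total 0 l
    simp only [Set.mem_ofPred_eq, Set.mem_union]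
    tauto
  rw [hsplit, Set.infinite_union] at h
  rcases h with h | h
  · exact right u hu h l
  · have h2 := right (fun l => u (-l)) (fun m l => by
      rw [fwdDiff_iter_comp_neg]
      rcases neg_one_pow_eq_or ℤ m with h | h <;> simpa [h] using hu m _) (by
      refine (h.image (f := fun i : ℤ => -i) neg_injective.injOn).mono ?_
      rintro _ ⟨i, ⟨hi, h0⟩, rfl⟩
      exact ⟨neg_nonneg.2 hi, by simpa using h0⟩) (-l)
    simpa using h2

end Interpolation

/-! ### Polynomial maps close to the identity -/

section NearIdentity

open Finset MvPolynomial

variable {B : Type*} [CommRing B] {n : ℕ}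

theorem eval_bind₁_eq (g : Fin n → MvPolynomial (Fin n) B) (f : MvPolynomial (Fin n) B)
    (x : Fin n → B) : eval x (bind₁ g f) = eval (fun i => eval x (g i)) f := by
  simp only [← coe_aeval_eq_eval, RingHom.coe_coe, aeval_bind₁]

theorem dvd_eval_sub_eval {c : B} {x y : Fin n → B} (h : ∀ i, c ∣ x i - y i)
    (f : MvPolynomial (Fin n) B) : c ∣ eval x f - eval y f := by
  induction f using MvPolynomial.induction_on with
  | C a => simp
  | add f g hf hg =>
    rw [map_add, map_add, add_sub_add_comm]
    exact dvd_add hf hg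
  | mul_X f i hf =>
    rw [map_mul, map_mul, eval_X, eval_X]
    convert dvd_add (hf.mul_right (x i)) ((h i).mul_left (eval y f)) using 1
    ring

theorem IsPolynomialMap.dvd_sub {f : (Fin n → B) → (Fin n → B)} (hf : IsPolynomialMap f) {c : B}
    {x y : Fin n → B} (h : ∀ i, c ∣ x i - y i) (i : Fin n) : c ∣ f x i - f y i := by
  obtain ⟨H, hH⟩ := hf
  rw [hH, hH]
  exact dvd_eval_sub_eval h _

/-- First-order Taylor expansion of a polynomial on a `P`-adic neighbourhood of `q`. -/
theorem exists_eval_add_mul_eq (P : B) (q : Fin n → B) (f : MvPolynomial (Fin n) B) :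
    ∃ (c₀ : B) (c : Fin n → B) (g : MvPolynomial (Fin n) B), ∀ z : Fin n → B,
      eval (fun i => q i + P * z i) f = c₀ + P * ∑ i, c i * z i + P ^ 2 * eval z g := by
  induction f using MvPolynomial.induction_on with
  | C a => exact ⟨a, 0, 0, fun z => by simp⟩
  | add f₁ f₂ h₁ h₂ =>
    obtain ⟨a₁, c₁, g₁, h₁⟩ := h₁
    obtain ⟨a₂, c₂, g₂, h₂⟩ := h₂
    refine ⟨a₁ + a₂, c₁ + c₂, g₁ + g₂, fun z => ?_⟩
    simp only [map_add, h₁, h₂, Pi.add_apply, add_mul, sum_add_distrib]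
    ring
  | mul_X f j h =>
    obtain ⟨a, c, g, h⟩ := h
    refine ⟨a * q j, fun i => c i * q j + if i = j then a else 0,
      g * (C (q j) + C P * X j) + (∑ i, C (c i) * X i) * X j, fun z => ?_⟩
    simp only [map_add, map_mul, map_sum, eval_X, eval_C, h, add_mul, sum_add_distrib, ite_mul,
      zero_mul, sum_ite_eq', mem_univ, if_true]
    have : ∑ i, c i * q j * z i = (∑ i, c i * z i) * q j := by
      rw [sum_mul]
      exact sum_congr rfl fun i _ => by ring
    rw [this]
    ring

theorem exists_eval_add_mul_sub_eq (P : B) (g : Fin n → MvPolynomial (Fin n) B)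
    (h : MvPolynomial (Fin n) B) :
    ∃ h' : MvPolynomial (Fin n) B, ∀ z : Fin n → B,
      eval (fun i => z i + P * eval z (g i)) h - eval z h = P * eval z h' := by
  induction h using MvPolynomial.induction_on with
  | C a => exact ⟨0, fun z => by simp⟩
  | add f₁ f₂ h₁ h₂ =>
    obtain ⟨g₁, h₁⟩ := h₁
    obtain ⟨g₂, h₂⟩ := h₂
    refine ⟨g₁ + g₂, fun z => ?_⟩
    rw [map_add, map_add, map_add, add_sub_add_comm, h₁, h₂, mul_add]
  | mul_X f j h =>
    obtain ⟨f', h⟩ := h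
    refine ⟨f' * X j + (f + C P * f') * g j, fun z => ?_⟩
    have := eq_add_of_sub_eq (h z)
    simp only [map_add, map_mul, eval_X, eval_C, this]
    ring

/-- A polynomial map that is the identity modulo `P ^ 2` as a function has, around every point, the
form `z ↦ z + P * g z` in the coordinate `z` with `x = q + P * z`: evaluating its Taylor expansion
at `0` and at the unit vectors determines the linear part modulo `P`. -/
theorem exists_eq_add_mul_of_dvd_sub {P : B} {T : (Fin n → B) → (Fin n → B)}
    (hT : IsPolynomialMap T) (hTid : ∀ x i, P ^ 2 ∣ T x i - x i) (q : Fin n → B) :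
    ∃ g : Fin n → MvPolynomial (Fin n) B, ∀ z i,
      T (fun i => q i + P * z i) i = q i + P * (z i + P * eval z (g i)) := by
  obtain ⟨H, hH⟩ := hT
  suffices ∀ i, ∃ g : MvPolynomial (Fin n) B, ∀ z,
      T (fun i => q i + P * z i) i = q i + P * (z i + P * eval z g) by
    choose g hg using this
    exact ⟨g, fun z i => hg i z⟩
  intro i
  obtain ⟨c₀, c, g, hg⟩ := exists_eval_add_mul_eq P q (H i)
  obtain ⟨d₀, hd₀⟩ : P ^ 2 ∣ c₀ - q i := by
    have h1 := hTid (fun i => q i + P * (0 : Fin n → B) i) i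
    rw [hH, hg] at h1
    have h2 := dvd_sub h1 (Dvd.intro (eval 0 g) rfl)
    rw [sub_right_comm] at h2
    simpa using h2
  -- the value at the `k`-th unit vector gives `c k = δ_{ik}`, multiplied by `P`, modulo `P ^ 2`
  have hlin : ∀ k, P ^ 2 ∣ P * c k - P * if i = k then 1 else 0 := fun k => by
    have h1 := hTid (fun i => q i + P * (Pi.single k 1 : Fin n → B) i) i
    rw [hH, hg] at h1
    have h2 := dvd_sub h1 (Dvd.intro (eval (Pi.single k 1) g + d₀) rfl)
    simp only [Pi.single_apply, mul_ite, mul_one, mul_zero, sum_ite_eq', mem_univ, if_true] at h2 ⊢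
    convert h2 using 1
    rw [eq_add_of_sub_eq hd₀]
    ring
  choose d hd using hlin
  refine ⟨g + C d₀ + ∑ k, C (d k) * X k, fun z => ?_⟩
  have hsum : P * ∑ k, c k * z k = P * z i + P ^ 2 * ∑ k, d k * z k := by
    have : ∀ k, P * (c k * z k) = P * (if i = k then z k else 0) + P ^ 2 * (d k * z k) := fun k => by
      rw [← mul_assoc, ← mul_assoc, ← hd k]
      split_ifs <;> ring
    rw [mul_sum, sum_congr rfl fun k _ => this k, sum_add_distrib, ← mul_sum, ← mul_sum]
    simp
  rw [hH, hg, hsum, eq_add_of_sub_eq hd₀]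
  simp only [map_add, map_sum, map_mul, eval_X, eval_C]
  ring

/-- Along an orbit of `z ↦ z + P * g z`, taking differences of a polynomial sequence gains a factor
`P` and leaves a polynomial sequence. -/
theorem pow_dvd_fwdDiff_iter {P : B} {g : Fin n → MvPolynomial (Fin n) B} {z : ℤ → Fin n → B}
    (hz : ∀ l i, z (l + 1) i = z l i + P * eval (z l) (g i)) (m : ℕ)
    (h : MvPolynomial (Fin n) B) (l : ℤ) :
    P ^ m ∣ ((fwdDiff 1)^[m] fun l => eval (z l) h) l := by
  induction m generalizing h with
  | zero => simp
  | succ m ih =>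
    obtain ⟨h', hh'⟩ := exists_eval_add_mul_sub_eq P g h
    have : (fwdDiff 1 fun l => eval (z l) h) = P • fun l => eval (z l) h' := by
      funext l
      rw [fwdDiff, funext (hz l), hh', Pi.smul_apply, smul_eq_mul]
    rw [Function.iterate_succ_apply, this, fwdDiff_iter_const_smul, Pi.smul_apply, smul_eq_mul,
      pow_succ']
    exact mul_dvd_mul_left _ (ih h')

/-- If residues modulo `c` are separated by a map to a finite set, some positive power of a
polynomial automorphism is congruent to the identity modulo `c`. -/
theorem exists_pow_dvd_sub (σ : affineAut B n) (c : B) {C : Type*} [Finite C] (π : B → C)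
    (hπ : ∀ x y, π x = π y → c ∣ x - y) :
    ∃ j > 0, ∀ x i, c ∣ (σ ^ j : affineAut B n).1 x i - x i := by
  have hpow : ∀ (k : ℤ) {x y : Fin n → B}, (∀ i, c ∣ x i - y i) →
      ∀ i, c ∣ (σ ^ k : affineAut B n).1 x i - (σ ^ k : affineAut B n).1 y i :=
    fun k x y h i => (σ ^ k).2.1.dvd_sub h i
  let s : (Fin n → C) → (Fin n → B) := fun w i => Function.invFun π (w i)
  have hs : ∀ (x : Fin n → B) i, c ∣ x i - s (fun i => π (x i)) i := fun x i =>
    hπ _ _ (Function.invFun_eq ⟨x i, rfl⟩).symm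
  -- the maps induced by the powers of `σ` on residues cannot all be distinct
  obtain ⟨k, l, hkl, heq⟩ := Finite.exists_ne_map_eq_of_infinite
    fun (k : ℕ) (w : Fin n → C) (i : Fin n) => π ((σ ^ (k : ℤ) : affineAut B n).1 (s w) i)
  wlog hlt : k < l generalizing k l
  · exact this l k hkl.symm heq.symm (lt_of_le_of_ne (not_lt.1 hlt) hkl.symm)
  have hcongr : ∀ x i, c ∣ (σ ^ (l : ℤ) : affineAut B n).1 x i -
      (σ ^ (k : ℤ) : affineAut B n).1 x i := fun x i => by
    have h1 := hpow l (hs x) i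
    have h2 := hpow k (hs x) i
    have h3 := hπ _ _ (congrFun (congrFun heq fun i => π (x i)) i)
    convert dvd_sub (dvd_sub h1 h2) h3 using 1
    ring
  refine ⟨l - k, Nat.sub_pos_of_lt hlt, fun x i => ?_⟩
  have h := hpow (-k) (hcongr x) i
  rw [← Equiv.Perm.mul_apply, ← Equiv.Perm.mul_apply, ← Subgroup.coe_mul, ← Subgroup.coe_mul,
    ← zpow_add, ← zpow_add, neg_add_cancel, zpow_zero] at h
  rw [← zpow_natCast, Nat.cast_sub hlt.le, sub_eq_neg_add (l : ℤ)]
  exact h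

end NearIdentity

/-! ### Orbits over finite free `ℤ_[p]`-algebras -/

section PadicAlgebra

open MvPolynomial

variable {p : ℕ} [Fact p.Prime] {B : Type*} [CommRing B] [Algebra ℤ_[p] B]

theorem algebraMap_dvd_of_dvd_repr {ι : Type*} [Fintype ι] (b : Module.Basis ι ℤ_[p] B) {a : ℤ_[p]}
    {x : B} (h : ∀ i, a ∣ b.repr x i) : algebraMap ℤ_[p] B a ∣ x := by
  choose d hd using h
  refine ⟨∑ i, d i • b i, ?_⟩
  rw [← Algebra.smul_def, Finset.smul_sum]
  conv_lhs => rw [← b.sum_repr x]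
  exact Finset.sum_congr rfl fun i _ => by rw [hd, mul_smul]

/-- The coordinates of an orbit of polynomial values with respect to a basis of `B` over `ℤ_[p]`
are sequences with highly divisible differences, so the orbit cannot have infinitely many zeros
unless it vanishes. -/
theorem eval_eq_zero_of_infinite_zeros [Module.Free ℤ_[p] B] {n : ℕ}
    {g : Fin n → MvPolynomial (Fin n) B} {z : ℤ → Fin n → B}
    (hz : ∀ l i, z (l + 1) i = z l i + algebraMap ℤ_[p] B ((p : ℤ_[p]) ^ 2) * eval (z l) (g i))
    {h : MvPolynomial (Fin n) B} (hinf : {l : ℤ | eval (z l) h = 0}.Infinite) (l : ℤ) :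
    eval (z l) h = 0 := by
  let b := Module.Free.chooseBasis ℤ_[p] B
  refine b.ext_elem fun i => ?_
  rw [map_zero, Finsupp.zero_apply]
  let φ : B →ₗ[ℤ_[p]] ℤ_[p] := b.coord i
  have hφ : ∀ (m : ℕ) (u : ℤ → B) l, ((fwdDiff 1)^[m] fun l => φ (u l)) l =
      φ (((fwdDiff 1)^[m] u) l) := fun m u l => by
    induction m generalizing l with
    | zero => rfl
    | succ m ih =>
      rw [Function.iterate_succ_apply', Function.iterate_succ_apply', fwdDiff, fwdDiff, ih, ih,
        map_sub]
  refine eq_zero_of_infinite_zeros (u := fun l => φ (eval (z l) h)) (fun m l => ?_)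
    (hinf.mono fun l hl => ?_) l
  · rw [hφ]
    obtain ⟨w, hw⟩ := pow_dvd_fwdDiff_iter hz m h l
    rw [hw, ← map_pow, ← Algebra.smul_def, map_smul, smul_eq_mul, ← pow_mul]
    exact Dvd.intro _ rfl
  · simp only [Set.mem_ofPred_eq] at hl ⊢
    rw [hl, map_zero]

/-- There is a period `j`, depending only on the automorphism, such that on every residue class
modulo `j` every polynomial vanishes along an orbit finitely often or always. -/
theorem exists_period_zeros_finite_or_all (p : ℕ) [Fact p.Prime] {B : Type*} [CommRing B]
    [Algebra ℤ_[p] B] [Module.Free ℤ_[p] B] [Module.Finite ℤ_[p] B] {n : ℕ} (σ : affineAut B n) :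
    ∃ j : ℕ, 0 < j ∧ ∀ (q : Fin n → B) (h : MvPolynomial (Fin n) B) (r : ℤ),
      {l : ℤ | eval ((σ ^ (r + j * l) : affineAut B n).1 q) h = 0}.Infinite →
      ∀ l : ℤ, eval ((σ ^ (r + j * l) : affineAut B n).1 q) h = 0 := by
  let b := Module.Free.chooseBasis ℤ_[p] B
  set P : B := algebraMap ℤ_[p] B ((p : ℤ_[p]) ^ 2) with hP
  have hp0 : ((p : ℤ_[p]) ^ 2) ≠ 0 :=
    pow_ne_zero _ (Nat.cast_ne_zero.2 (Fact.out : p.Prime).ne_zero)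
  have hPcancel : ∀ {x y : B}, P * x = P * y → x = y := fun {x y} hxy => by
    rw [hP, ← Algebra.smul_def, ← Algebra.smul_def] at hxy
    exact smul_right_injective B hp0 hxy
  have : NeZero (p ^ 4) := ⟨pow_ne_zero _ (Fact.out : p.Prime).ne_zero⟩
  obtain ⟨j, hj, hid⟩ := exists_pow_dvd_sub σ (P ^ 2)
    (fun x i => PadicInt.toZModPow (p := p) 4 (b.repr x i)) fun x y hxy => by
      rw [hP, ← map_pow, ← pow_mul]
      refine algebraMap_dvd_of_dvd_repr b fun i => ?_
      have := congrFun hxy i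
      rw [← sub_eq_zero, ← map_sub, ← RingHom.mem_ker, PadicInt.ker_toZModPow,
        Ideal.mem_span_singleton] at this
      simpa using this
  refine ⟨j, hj, fun q h r hinf l => ?_⟩
  let y : ℤ → Fin n → B := fun l => (σ ^ (r + j * l) : affineAut B n).1 q
  have hstep : ∀ l, y (l + 1) = (σ ^ j : affineAut B n).1 (y l) := fun l => by
    have hexp : r + j * (l + 1) = j + (r + j * l) := by ring
    change (σ ^ (r + j * (l + 1)) : affineAut B n).1 q = _
    rw [hexp, zpow_add, zpow_natCast]
    rfl
  -- the orbit of the `j`-th power stays in the `P`-adic neighbourhood `y 0 + P * z`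
  have hmod : ∀ l i, P ∣ y l i - y 0 i := fun l i => by
    have hd : ∀ l, P ∣ y (l + 1) i - y l i := fun l => by
      rw [hstep]
      exact (Dvd.intro_left _ (pow_succ P 1).symm).trans (hid _ _)
    induction l using Int.induction_on with
    | zero => simp
    | succ l ih => simpa using dvd_add (hd l) ih
    | pred l ih => simpa using dvd_sub ih (hd (-l - 1))
  choose z hz using hmod
  have hyz : ∀ l, y l = fun i => y 0 i + P * z l i := fun l => funext fun i => by
    rw [← hz, add_sub_cancel]
  obtain ⟨g, hg⟩ := exists_eq_add_mul_of_dvd_sub (σ ^ j).2.1 hid (y 0)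
  have hrec : ∀ l i, z (l + 1) i = z l i + P * eval (z l) (g i) := fun l i => by
    refine hPcancel (add_left_cancel (a := y 0 i) ?_)
    rw [← hg, ← hyz, ← hstep, ← congrFun (hyz (l + 1)) i]
  have heval : ∀ l, eval (y l) h = eval (z l) (bind₁ (fun i => C (y 0 i) + C P * X i) h) :=
    fun l => by
      rw [eval_bind₁_eq, hyz l]
      simp
  change {l | eval (y l) h = 0}.Infinite at hinf
  change eval (y l) h = 0
  simp only [heval] at hinf ⊢
  exact eval_eq_zero_of_infinite_zeros hrec hinf l

end PadicAlgebra

/-! ### Embedding finitely generated domains into finite `ℤ_[p]`-algebras -/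

section Embedding

open MvPolynomial Cardinal

/-- By cardinality, `ℚ_[p]` has infinite transcendence degree over `ℚ`; a transcendence basis can
be chosen inside `ℤ_[p]`, which generates `ℚ_[p]` as a field. -/
theorem exists_algebraicIndependent_padicInt (p : ℕ) [Fact p.Prime] (r : ℕ) :
    ∃ τ : Fin r → ℤ_[p], AlgebraicIndependent ℚ fun i => (τ i : ℚ_[p]) := by
  let s : Set ℚ_[p] := Set.range ((↑) : ℤ_[p] → ℚ_[p])
  have halg : Algebra.IsAlgebraic (Algebra.adjoin ℚ s) ℚ_[p] := ⟨fun x => by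
    obtain ⟨a, b, -, rfl⟩ := IsFractionRing.div_surjective (A := ℤ_[p]) x
    have hmem : ∀ a : ℤ_[p], IsAlgebraic (Algebra.adjoin ℚ s) (a : ℚ_[p]) := fun a =>
      isAlgebraic_algebraMap (⟨a, Algebra.subset_adjoin ⟨a, rfl⟩⟩ : Algebra.adjoin ℚ s)
    rw [div_eq_mul_inv]
    exact (hmem a).mul (hmem b).inv⟩
  obtain ⟨t, hts, ht⟩ := exists_isTranscendenceBasis_subset (R := ℚ) s
  have hinf : Infinite t := by
    by_contra hfin
    rw [not_infinite_iff_finite] at hfin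
    have h1 := ht.isAlgebraic
    have h2 : #ℚ_[p] ≤ ℵ₀ := by
      refine (Algebra.IsAlgebraic.cardinalMk_le_max
        (Algebra.adjoin ℚ (Set.range ((↑) : t → ℚ_[p]))) ℚ_[p]).trans (max_le ?_ le_rfl)
      rw [← Cardinal.mk_congr ht.1.aevalEquiv.toEquiv]
      refine (MvPolynomial.cardinalMk_le_max_lift).trans ?_
      simp [Cardinal.mk_le_aleph0]
    exact absurd ((continuum_le_cardinal_of_nontriviallyNormedField ℚ_[p]).trans h2)
      (not_le.2 aleph0_lt_continuum)
  let e : Fin r ↪ t := (Fin.valEmbedding).trans (Infinite.natEmbedding t)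
  choose τ hτ using fun i => hts (e i).2
  refine ⟨τ, ?_⟩
  simp only [hτ]
  exact ht.1.comp e e.injective

theorem exists_prime_forall_not_dvd_den {D : Set ℚ} (hD : D.Finite) :
    ∃ p : ℕ, p.Prime ∧ ∀ d ∈ D, ¬p ∣ d.den := by
  obtain ⟨N, hN⟩ := (hD.image Rat.den).bddAbove
  obtain ⟨p, hNp, hp⟩ := Nat.exists_infinite_primes (N + 1)
  refine ⟨p, hp, fun d hd hdvd => ?_⟩
  have := hN ⟨d, hd, rfl⟩
  have := Nat.le_of_dvd d.den_pos hdvd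
  omega

theorem aeval_mem_padicInt_subring {p : ℕ} [Fact p.Prime] {r : ℕ} (τ : Fin r → ℤ_[p])
    {f : MvPolynomial (Fin r) ℚ} (hf : ∀ c ∈ f.coeffs, ¬p ∣ c.den) :
    ∃ a : ℤ_[p], aeval (fun i => (τ i : ℚ_[p])) f = a := by
  suffices aeval (fun i => (τ i : ℚ_[p])) f ∈ PadicInt.subring p from ⟨⟨_, this⟩, rfl⟩
  rw [aeval_def, eval₂_eq']
  refine Subring.sum_mem _ fun d hd => Subring.mul_mem _ ?_ ?_
  · have := Padic.norm_rat_le_one (hf _ (coeff_mem_coeffs _ (mem_support_iff.1 hd)))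
    simpa using this
  · exact Subring.prod_mem _ fun i _ => Subring.pow_mem _ (τ i).2 _

/-- A finite set `S` in a field of characteristic zero is contained in a subring `R₀` that embeds
into a domain `B` that is finite over some `ℤ_[p]`. By Noether normalization `ℚ[S]` is integral over
a polynomial ring; the variables are sent to algebraically independent `p`-adic integers and the
map extends to an algebraic closure of `ℚ_[p]`. If `p` avoids the denominators of the integral
equations of the elements of `S`, these elements become integral over `ℤ_[p]`. -/
theorem exists_injective_hom_finite_padicInt_algebra {K : Type*} [Field K] [CharZero K] {S : Set K}
    (hS : S.Finite) :
    ∃ (p : ℕ) (_ : Fact p.Prime) (B : Subalgebra ℤ_[p] (AlgebraicClosure ℚ_[p]))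
      (_ : Module.Finite ℤ_[p] B) (R₀ : Subring (Algebra.adjoin ℚ S)) (φ : R₀ →+* B),
      Function.Injective φ ∧ ∀ s ∈ S, ∃ x : R₀, ((x : Algebra.adjoin ℚ S) : K) = s := by
  let A := Algebra.adjoin ℚ S
  have hA : Algebra.FiniteType ℚ A :=
    (Subalgebra.fg_iff_finiteType A).1 ⟨hS.toFinset, by rw [hS.coe_toFinset]⟩
  obtain ⟨r, g, hginj, hgint⟩ := exists_integral_inj_algHom_of_fg ℚ A
  have hroot : ∀ x : A, ∃ P : Polynomial (MvPolynomial (Fin r) ℚ),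
      P.Monic ∧ Polynomial.eval₂ g.toRingHom x P = 0 := fun x => hgint x
  choose P hPmonic hProot using hroot
  let S' : Set A := {x | (x : K) ∈ S}
  have hS' : S'.Finite := hS.preimage Subtype.val_injective.injOn
  obtain ⟨p, hp, hpD⟩ := exists_prime_forall_not_dvd_den
    (D := ⋃ x ∈ S', ⋃ i ∈ (P x).support, (((P x).coeff i).coeffs : Set ℚ))
    (hS'.biUnion fun x _ => (P x).support.finite_toSet.biUnion fun i _ => Finset.finite_toSet _)
  have : Fact p.Prime := ⟨hp⟩
  obtain ⟨τ, hτ⟩ := exists_algebraicIndependent_padicInt p r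
  let Ω := AlgebraicClosure ℚ_[p]
  let ψ : MvPolynomial (Fin r) ℚ →+* Ω :=
    (algebraMap ℚ_[p] Ω).comp (aeval fun i => (τ i : ℚ_[p])).toRingHom
  have hψ : Function.Injective ψ := (algebraMap ℚ_[p] Ω).injective.comp hτ
  let : Algebra (MvPolynomial (Fin r) ℚ) A := g.toRingHom.toAlgebra
  let : Algebra (MvPolynomial (Fin r) ℚ) Ω := ψ.toAlgebra
  have : Algebra.IsIntegral (MvPolynomial (Fin r) ℚ) A := ⟨hgint⟩
  have : FaithfulSMul (MvPolynomial (Fin r) ℚ) A :=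
    (faithfulSMul_iff_algebraMap_injective _ _).2 hginj
  have : FaithfulSMul (MvPolynomial (Fin r) ℚ) Ω :=
    (faithfulSMul_iff_algebraMap_injective _ _).2 hψ
  let Φ : A →ₐ[MvPolynomial (Fin r) ℚ] Ω := IsAlgClosed.lift
  -- an ideal of `A` meeting the polynomial ring trivially is trivial
  have hΦ : Function.Injective Φ := by
    refine (RingHom.injective_iff_ker_eq_bot Φ.toRingHom).2
      (Ideal.eq_bot_of_comap_eq_bot (R := MvPolynomial (Fin r) ℚ) ?_)
    have hcomp : Φ.toRingHom.comp (algebraMap (MvPolynomial (Fin r) ℚ) A) = ψ :=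
      Φ.comp_algebraMap
    rw [RingHom.comap_ker, hcomp]
    exact (RingHom.injective_iff_ker_eq_bot ψ).1 hψ
  -- by the choice of `p`, the integral equations of `S` are sent to equations over `ℤ_[p]`
  have hint : ∀ x ∈ S', IsIntegral ℤ_[p] (Φ x) := fun x hx => by
    have hlift : (P x).map ψ ∈ Polynomial.lifts (algebraMap ℤ_[p] Ω) := by
      rw [Polynomial.lifts_iff_coeff_lifts]
      intro i
      rw [Polynomial.coeff_map]
      by_cases hi : (P x).coeff i = 0
      · exact ⟨0, by rw [hi, map_zero, map_zero]⟩
      · obtain ⟨a, ha⟩ := aeval_mem_padicInt_subring τ (f := (P x).coeff i) fun c hc =>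
          hpD c (Set.mem_biUnion hx (Set.mem_biUnion (Polynomial.mem_support_iff.2 hi) hc))
        refine ⟨a, ?_⟩
        rw [IsScalarTower.algebraMap_apply ℤ_[p] ℚ_[p] Ω]
        exact congrArg (algebraMap ℚ_[p] Ω) ha.symm
    obtain ⟨Q, hQ, -, hQmonic⟩ :=
      Polynomial.lifts_and_degree_eq_and_monic hlift ((hPmonic x).map ψ)
    refine ⟨Q, hQmonic, ?_⟩
    rw [← Polynomial.eval_map, hQ, Polynomial.eval_map]
    have := congrArg Φ (hProot x)
    rw [map_zero] at this
    rw [← this]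
    change _ = Φ.toRingHom _
    rw [Polynomial.hom_eval₂]
    congr 1
    exact Φ.comp_algebraMap.symm
  let B : Subalgebra ℤ_[p] Ω := Algebra.adjoin ℤ_[p] (Φ '' S')
  have hB : Module.Finite ℤ_[p] B :=
    Algebra.finite_adjoin_of_finite_of_isIntegral (hS'.image _) (by
      rintro _ ⟨x, hx, rfl⟩
      exact hint x hx)
  refine ⟨p, ‹_›, B, hB, B.toSubring.comap Φ.toRingHom,
    (Φ.toRingHom.comp (Subring.subtype _)).codRestrict B fun x => x.2, fun x y hxy => ?_,
    fun s hs => ?_⟩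
  · exact Subtype.ext (hΦ (congrArg Subtype.val hxy))
  · let x : A := ⟨s, Algebra.subset_adjoin hs⟩
    exact ⟨⟨x, Algebra.subset_adjoin ⟨x, hs, rfl⟩⟩, rfl⟩

end Embedding

/-! ### Descent of polynomial automorphisms to subrings -/

section Descent

open MvPolynomial

variable {R S : Type*} [CommRing R] [CommRing S] {n : ℕ}

theorem apply_eval_eq_eval_map (f : R →+* S) (x : Fin n → R) (h : MvPolynomial (Fin n) R) :
    f (eval x h) = eval (f ∘ x) (map f h) := by
  induction h using MvPolynomial.induction_on with
  | C a => simp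
  | add g h hg hh => simp [hg, hh]
  | mul_X g i hg => simp [hg]

/-- The automorphism of affine space given by two mutually inverse tuples of polynomials. -/
noncomputable def affineAutOfPolynomials (H G : Fin n → MvPolynomial (Fin n) R)
    (hGH : ∀ i, bind₁ H (G i) = X i) (hHG : ∀ i, bind₁ G (H i) = X i) : affineAut R n :=
  ⟨{ toFun := fun x i => eval x (H i)
     invFun := fun x i => eval x (G i)
     left_inv := fun x => funext fun i => by
       simpa only [hGH, eval_X] using (eval_bind₁_eq H (G i) x).symm
     right_inv := fun x => funext fun i => by
       simpa only [hHG, eval_X] using (eval_bind₁_eq G (H i) x).symm },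
    ⟨H, fun _ _ => rfl⟩, ⟨G, fun _ _ => rfl⟩⟩

theorem map_zpow_apply_of_map_apply {f : R →+* S} {σ : affineAut R n} {σ' : affineAut S n}
    (h : ∀ x, f ∘ σ.1 x = σ'.1 (f ∘ x)) (m : ℤ) (x : Fin n → R) :
    f ∘ (σ ^ m : affineAut R n).1 x = (σ' ^ m : affineAut S n).1 (f ∘ x) := by
  have hinv : ∀ x, f ∘ (σ⁻¹ : affineAut R n).1 x = (σ'⁻¹ : affineAut S n).1 (f ∘ x) := fun x => by
    refine (Equiv.eq_symm_apply σ'.1).2 ?_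
    rw [← h]
    exact congrArg (f ∘ ·) (Equiv.apply_symm_apply σ.1 x)
  induction m using Int.induction_on generalizing x with
  | zero => rfl
  | succ m ih =>
    rw [zpow_add_one, zpow_add_one]
    exact (ih (σ.1 x)).trans (congrArg _ (h x))
  | pred m ih =>
    rw [zpow_sub_one, zpow_sub_one]
    exact (ih _).trans (congrArg _ (hinv x))

/-- Polynomials over an infinite field are determined by their values, so tuples inducing mutually
inverse maps are formally inverse; this identity survives descent and base change. -/
theorem bind₁_eq_X_of_leftInverse {K : Type*} [Field K] [CharZero K]
    {H G : Fin n → MvPolynomial (Fin n) K}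
    (h : ∀ x i, eval (fun j => eval x (H j)) (G i) = x i) (i : Fin n) : bind₁ H (G i) = X i :=
  MvPolynomial.funext fun x => by rw [eval_bind₁_eq, h, eval_X]

theorem bind₁_eq_X_of_map {f : R →+* S} (hf : Function.Injective f)
    {H G : Fin n → MvPolynomial (Fin n) R} {i : Fin n}
    (h : bind₁ (fun j => map f (H j)) (map f (G i)) = X i) : bind₁ H (G i) = X i :=
  map_injective f hf (by rw [map_bind₁, h, map_X])

/-- If `R` embeds into a finite free `ℤ_[p]`-algebra, the zeros of polynomials along an orbit of an
automorphism over `R` are periodic up to finite sets. -/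
theorem exists_period_of_injective_hom {p : ℕ} [Fact p.Prime] {B : Type*} [CommRing B]
    [Algebra ℤ_[p] B] [Module.Free ℤ_[p] B] [Module.Finite ℤ_[p] B]
    {φ : R →+* B} (hφ : Function.Injective φ) (H G : Fin n → MvPolynomial (Fin n) R)
    (hGH : ∀ i, bind₁ H (G i) = X i) (hHG : ∀ i, bind₁ G (H i) = X i) :
    ∃ j : ℕ, 0 < j ∧ ∀ (q : Fin n → R) (h : MvPolynomial (Fin n) R) (r : ℤ),
      {l : ℤ | eval ((affineAutOfPolynomials H G hGH hHG ^ (r + j * l) : affineAut R n).1 q) h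
        = 0}.Infinite →
      ∀ l : ℤ, eval ((affineAutOfPolynomials H G hGH hHG ^ (r + j * l) : affineAut R n).1 q) h
        = 0 := by
  let σ' : affineAut B n := affineAutOfPolynomials (fun i => map φ (H i)) (fun i => map φ (G i))
    (fun i => by rw [← map_bind₁, hGH, map_X]) (fun i => by rw [← map_bind₁, hHG, map_X])
  obtain ⟨j, hj, hper⟩ := exists_period_zeros_finite_or_all p σ'
  have hσ : ∀ x, φ ∘ (affineAutOfPolynomials H G hGH hHG).1 x = σ'.1 (φ ∘ x) := fun x =>
    funext fun i => apply_eval_eq_eval_map φ x (H i)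
  refine ⟨j, hj, fun q h r => ?_⟩
  have key : ∀ m : ℤ, eval ((affineAutOfPolynomials H G hGH hHG ^ m : affineAut R n).1 q) h = 0 ↔
      eval ((σ' ^ m : affineAut B n).1 (φ ∘ q)) (map φ h) = 0 := fun m => by
    rw [← map_zpow_apply_of_map_apply hσ, ← map_eq_zero_iff φ hφ, apply_eval_eq_eval_map]
  simp only [key]
  exact hper _ _ r

end Descent

/-! ### Return sets of orbits to subvarieties -/

section ReturnSet

open MvPolynomial

/-- Over a field of characteristic zero, an automorphism, a point and finitely many polynomials
admit a period on whose residue classes each polynomial vanishes finitely often or always along the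
orbit of the point. -/
theorem exists_period_affineAut {K : Type*} [Field K] [CharZero K] {n : ℕ} (σ : affineAut K n)
    (q : Fin n → K) (s : Finset (MvPolynomial (Fin n) K)) :
    ∃ j : ℕ, 0 < j ∧ ∀ f ∈ s, ∀ r : ℤ,
      {l : ℤ | eval ((σ ^ (r + j * l) : affineAut K n).1 q) f = 0}.Infinite →
      ∀ l : ℤ, eval ((σ ^ (r + j * l) : affineAut K n).1 q) f = 0 := by
  obtain ⟨H, hH⟩ := σ.2.1
  obtain ⟨G, hG⟩ := σ.2.2
  let S : Set K := Set.range q ∪ ((⋃ i, (H i).coeffs) ∪ (⋃ i, (G i).coeffs)) ∪ ⋃ f ∈ s, f.coeffs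
  have hS : S.Finite := ((Set.finite_range q).union
    ((Set.finite_iUnion fun i => Finset.finite_toSet _).union
      (Set.finite_iUnion fun i => Finset.finite_toSet _))).union
    (s.finite_toSet.biUnion fun f _ => Finset.finite_toSet _)
  obtain ⟨p, _, B, _, R₀, φ, hφ, hR₀⟩ := exists_injective_hom_finite_padicInt_algebra hS
  let ι : R₀ →+* K := (Algebra.adjoin ℚ S).val.toRingHom.comp R₀.subtype
  have hι : Function.Injective ι := Subtype.val_injective.comp Subtype.val_injective
  have hlift : ∀ f : MvPolynomial (Fin n) K, (f.coeffs : Set K) ⊆ S → ∃ f₀, map ι f₀ = f :=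
    fun f hf => mem_range_map_iff_coeffs_subset.2 (hf.trans hR₀)
  choose q₀ hq₀ using fun i => hR₀ (q i) (Or.inl (Or.inl ⟨i, rfl⟩))
  choose H₀ hH₀ using fun i => hlift (H i) fun c hc =>
    Or.inl (Or.inr (Or.inl (Set.mem_iUnion_of_mem i hc)))
  choose G₀ hG₀ using fun i => hlift (G i) fun c hc =>
    Or.inl (Or.inr (Or.inr (Set.mem_iUnion_of_mem i hc)))
  have hσ : ∀ x, σ.1 x = fun i => eval x (H i) := fun x => funext (hH x)
  have hσinv : ∀ x, σ.1⁻¹ x = fun i => eval x (G i) := fun x => funext (hG x)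
  have hGH : ∀ i, bind₁ H₀ (G₀ i) = X i := fun i => bind₁_eq_X_of_map hι (by
    simp only [hH₀, hG₀]
    refine bind₁_eq_X_of_leftInverse (fun x i => ?_) i
    rw [← hσ, ← hG]
    exact congrFun (Equiv.symm_apply_apply σ.1 x) i)
  have hHG : ∀ i, bind₁ G₀ (H₀ i) = X i := fun i => bind₁_eq_X_of_map hι (by
    simp only [hH₀, hG₀]
    refine bind₁_eq_X_of_leftInverse (fun x i => ?_) i
    rw [← hσinv, ← hH]
    exact congrFun (Equiv.apply_symm_apply σ.1 x) i)
  have : Module.IsTorsionFree ℤ_[p] B := by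
    refine Module.isTorsionFree_iff_algebraMap_injective.2 (Function.Injective.of_comp
      (f := ((↑) : B → AlgebraicClosure ℚ_[p])) ?_)
    change Function.Injective (algebraMap ℤ_[p] (AlgebraicClosure ℚ_[p]))
    rw [IsScalarTower.algebraMap_eq ℤ_[p] ℚ_[p]]
    exact (algebraMap ℚ_[p] _).injective.comp Subtype.val_injective
  obtain ⟨j, hj, hper⟩ := exists_period_of_injective_hom (p := p) hφ H₀ G₀ hGH hHG
  refine ⟨j, hj, fun f hf r => ?_⟩
  obtain ⟨f₀, rfl⟩ := hlift f fun c hc => Or.inr (Set.mem_biUnion hf hc)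
  have hcomm : ∀ x, ι ∘ (affineAutOfPolynomials H₀ G₀ hGH hHG).1 x = σ.1 (ι ∘ x) := fun x =>
    funext fun i => by
      rw [hσ]
      beta_reduce
      rw [← hH₀, ← apply_eval_eq_eval_map]
      rfl
  have hq : q = ι ∘ q₀ := funext fun i => (hq₀ i).symm
  have key : ∀ m : ℤ, eval ((σ ^ m : affineAut K n).1 q) (map ι f₀) = 0 ↔
      eval ((affineAutOfPolynomials H₀ G₀ hGH hHG ^ m : affineAut R₀ n).1 q₀) f₀ = 0 := fun m => by
    rw [hq, ← map_zpow_apply_of_map_apply hcomm, ← apply_eval_eq_eval_map, map_eq_zero_iff ι hι]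
  simp only [key]
  exact hper q₀ f₀ r

/-- A set of integers that is finite or everything on each residue class modulo `j` is the union of
a finite set and finitely many complete arithmetic progressions. -/
theorem exists_union_of_finite_or_all {M : Set ℤ} {j : ℕ} (hj : 0 < j)
    (h : ∀ r : ℤ, {l : ℤ | r + j * l ∈ M}.Infinite → ∀ l : ℤ, r + j * l ∈ M) :
    ∃ (P : Set (Set ℤ)) (F : Set ℤ), P.Finite ∧ (∀ A ∈ P, IsDoublyInfiniteAP A) ∧ F.Finite ∧
      M = ⋃₀ P ∪ F := by
  have hj0 : (j : ℤ) ≠ 0 := by exact_mod_cast hj.ne'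
  let AP : ℤ → Set ℤ := fun r => {m | ∃ l : ℤ, m = r + j * l}
  let I : Set ℤ := Set.Ico 0 (j : ℤ)
  have hI : I.Finite := Set.finite_Ico _ _
  refine ⟨AP '' {r ∈ I | ∀ l : ℤ, r + j * l ∈ M},
    ⋃ r ∈ {r ∈ I | ¬∀ l : ℤ, r + j * l ∈ M}, (fun l : ℤ => r + j * l) '' {l : ℤ | r + j * l ∈ M},
    (hI.subset fun r hr => hr.1).image _, ?_, ?_, ?_⟩
  · rintro _ ⟨r, -, rfl⟩
    exact ⟨r, j, hj0, rfl⟩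
  · exact (hI.subset fun r hr => hr.1).biUnion fun r hr =>
      (Set.not_infinite.1 fun hinf => hr.2 (h r hinf)).image _
  · refine Set.Subset.antisymm (fun m hm => ?_) (Set.union_subset ?_ ?_)
    · have hr : m % j ∈ I := ⟨Int.emod_nonneg _ hj0, Int.emod_lt_of_pos _ (by exact_mod_cast hj)⟩
      have hm' : m % j + j * (m / j) = m := Int.emod_add_mul_ediv m j
      by_cases hall : ∀ l : ℤ, m % j + j * l ∈ M
      · exact Or.inl ⟨AP (m % j), ⟨_, ⟨hr, hall⟩, rfl⟩, m / j, hm'.symm⟩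
      · refine Or.inr (Set.mem_biUnion ⟨hr, hall⟩ ⟨m / j, ?_, hm'⟩)
        rw [Set.mem_ofPred_eq, hm']
        exact hm
    · rintro m ⟨_, ⟨r, ⟨-, hr⟩, rfl⟩, l, rfl⟩
      exact hr l
    · intro m hm
      simp only [Set.mem_iUnion] at hm
      obtain ⟨r, -, l, hl, rfl⟩ := hm
      exact hl

end ReturnSet

theorem mainTheorem2 {K : Type*} [Field K] [CharZero K] (n : ℕ)
    (σ : affineAut K n) (q : Fin n → K)
    (X : Set (Fin n → K)) (hX : IsAffineSubvariety X) :
    ∃ (P : Set (Set ℤ)) (F : Set ℤ), P.Finite ∧ (∀ A ∈ P, IsDoublyInfiniteAP A) ∧ F.Finite ∧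
      {m : ℤ | (σ ^ m : affineAut K n).1 q ∈ X} = ⋃₀ P ∪ F := by
  obtain ⟨I, rfl⟩ := hX
  obtain ⟨s, hs⟩ := (isNoetherianRing_iff_ideal_fg _).1 inferInstance I
  obtain ⟨j, hj, hper⟩ := exists_period_affineAut σ q s
  refine exists_union_of_finite_or_all hj fun r hinf l => ?_
  simp only [Set.mem_ofPred_eq, ← hs, MvPolynomial.zeroLocus_span,
    MvPolynomial.aeval_eq_eval] at hinf ⊢
  refine fun f hf => hper f hf r (hinf.mono fun l hl => ?_) l
  simp only [Set.mem_ofPred_eq] at hl ⊢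
  exact hl f hf
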